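/- Let $S$ be a semifield, i.e. a commutative semiring with $1\neq 0$ in which every nonzero element has a multiplicative inverse. Let $\mathcal G$ be a nonempty ample groupoid, i.e. a topological groupoid (not necessarily Hausdorff) whose unit space $\mathcal G^{(0)}$ is locally compact, Hausdorff and totally disconnected, and whose source and range maps $s,r\colon\mathcal G\to\mathcal G^{(0)}$ are local homeomorphisms. A bisection is a subset $U\subseteq\mathcal G$ such that $s|_U$ and $r|_U$ are homeomorphisms onto their images. The Steinberg algebra $A_S(\mathcal G)$ is the $S$-submodule of $S^{\mathcal G}$ spanned by the characteristic functions $1_U$ of the compact open bisections $U$ of $\mathcal G$, with the convolution product $$(f*g)(\gamma)=\sum_{\alpha\beta=\gamma} f(\alpha)\,g(\beta).$$ Suppose that $A_S(\mathcal G)$ is congruence-simple, i.e. the only equivalence relations on $A_S(\mathcal G)$ that are compatible with addition and multiplication are the diagonal and the full relation. Then: 1. $S$ is either a field or (isomorphic to) the Boolean semifield $\mathbb B=(\{0,1\},\mathrm{or},\mathrm{and})$; 2. $\mathcal G$ is minimal, i.e. every open set $D\subseteq\mathcal G^{(0)}$ that is invariant ($s(\gamma)\in D$ implies $r(\gamma)\in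 D$ for all $\gamma\in\mathcal G$) is $\varnothing$ or $\mathcal G^{(0)}$; and $\mathcal G$ is effective, i.e. the interior of $\{\gamma\in\mathcal G\mid s(\gamma)=r(\gamma)\}$ in $\mathcal G$ equals $\mathcal G^{(0)}$. -/

import Mathlib

namespace Steinberg

open CategoryTheory Topology

universe v u w

/-- The set of all morphisms of a (small) groupoid with object set `X`. -/
@[ext]
structure Arr (X : Type u) [Groupoid.{v} X] where
  /-- source -/
  src : X
  /-- range -/
  tgt : X
  /-- the morphism -/
  hom : src ⟶ tgt

namespace Arr

variable {X : Type u} [Groupoid.{v} X]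

/-- The identity morphism of an object. -/
def unit (x : X) : Arr X := ⟨x, x, 𝟙 x⟩

/-- The inverse morphism. -/
def inv (α : Arr X) : Arr X := ⟨α.tgt, α.src, Groupoid.inv α.hom⟩

/-- The product `αβ` (first `β`, then `α`), defined if the source of `α` is the range of `β`. -/
def comp (α β : Arr X) (h : α.src = β.tgt) : Arr X :=
  ⟨β.src, α.tgt, β.hom ≫ eqToHom h.symm ≫ α.hom⟩

@[simp] lemma src_unit (x : X) : (unit x).src = x := rfl
@[simp] lemma tgt_unit (x : X) : (unit x).tgt = x := rfl
@[simp] lemma src_inv (α : Arr X) : α.inv.src = α.tgt := rfl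
@[simp] lemma tgt_inv (α : Arr X) : α.inv.tgt = α.src := rfl
@[simp] lemma src_comp (α β : Arr X) (h : α.src = β.tgt) : (comp α β h).src = β.src := rfl
@[simp] lemma tgt_comp (α β : Arr X) (h : α.src = β.tgt) : (comp α β h).tgt = α.tgt := rfl

lemma comp_assoc (α β γ : Arr X) (h : α.src = β.tgt) (h' : β.src = γ.tgt) :
    comp (comp α β h) γ h' = comp α (comp β γ h') h := by
  obtain ⟨a, b, f⟩ := α
  obtain ⟨c, d, g⟩ := β
  obtain ⟨i, j, k⟩ := γ
  dsimp only at h h'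
  subst h
  subst h'
  change Arr.mk i b (k ≫ 𝟙 c ≫ g ≫ 𝟙 a ≫ f) = Arr.mk i b ((k ≫ 𝟙 c ≫ g) ≫ 𝟙 a ≫ f)
  simp

lemma inv_comp_cancel (α β : Arr X) (h : α.src = β.tgt) :
    comp α.inv (comp α β h) rfl = β := by
  obtain ⟨a, b, f⟩ := α
  obtain ⟨c, d, g⟩ := β
  dsimp only at h
  subst h
  simp [comp, inv]

lemma comp_inv_cancel (α γ : Arr X) (h : α.tgt = γ.tgt) :
    comp α (comp α.inv γ h) rfl = γ := by
  obtain ⟨a, b, f⟩ := α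
  obtain ⟨c, d, g⟩ := γ
  dsimp only at h
  subst h
  simp [comp, inv]

end Arr

open Arr

/-- A topological groupoid.  The topology of the object set `X` is that of the subspace of units:
`Arr.unit` is continuous with continuous left inverse `Arr.src`, hence an embedding. -/
class TopologicalGroupoid (X : Type u) [Groupoid.{v} X] [TopologicalSpace X]
    [TopologicalSpace (Arr X)] : Prop where
  continuous_unit : Continuous (Arr.unit : X → Arr X)
  continuous_src : Continuous (Arr.src : Arr X → X)
  continuous_tgt : Continuous (Arr.tgt : Arr X → X)
  continuous_inv : Continuous (Arr.inv : Arr X → Arr X)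
  continuous_comp :
    Continuous fun p : {p : Arr X × Arr X // p.1.src = p.2.tgt} => comp p.1.1 p.1.2 p.2

/-- An étale groupoid: the unit space is locally compact Hausdorff, and source and range are local
homeomorphisms. -/
class EtaleGroupoid (X : Type u) [Groupoid.{v} X] [TopologicalSpace X]
    [TopologicalSpace (Arr X)] : Prop extends TopologicalGroupoid X where
  locallyCompactSpace : LocallyCompactSpace X
  t2Space : T2Space X
  isLocalHomeomorph_src : IsLocalHomeomorph (Arr.src : Arr X → X)
  isLocalHomeomorph_tgt : IsLocalHomeomorph (Arr.tgt : Arr X → X)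

/-- An ample groupoid: an étale groupoid with totally disconnected unit space. -/
class AmpleGroupoid (X : Type u) [Groupoid.{v} X] [TopologicalSpace X]
    [TopologicalSpace (Arr X)] : Prop extends EtaleGroupoid X where
  totallyDisconnectedSpace : TotallyDisconnectedSpace X

section Notions

variable (X : Type u) [Groupoid.{v} X]

/-- The isotropy subgroupoid. -/
def iso : Set (Arr X) := {γ | γ.src = γ.tgt}

variable {X} in
/-- Invariant sets of units. -/
def IsInvariant (D : Set X) : Prop := ∀ γ : Arr X, γ.src ∈ D → γ.tgt ∈ D

/-- There are no nontrivial open invariant sets of units. -/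
def IsMinimalGroupoid [TopologicalSpace X] : Prop :=
  ∀ D : Set X, IsOpen D → IsInvariant D → D = ∅ ∨ D = Set.univ

/-- The interior of the isotropy subgroupoid is the set of units. -/
def IsEffectiveGroupoid [TopologicalSpace (Arr X)] : Prop :=
  interior (iso X) = Set.range (Arr.unit : X → Arr X)

variable {X}

/-- A bisection: source and range restrict to homeomorphisms onto their images. -/
def IsBisection [TopologicalSpace X] [TopologicalSpace (Arr X)] (U : Set (Arr X)) : Prop :=
  IsEmbedding (U.domRestrict Arr.src) ∧ IsEmbedding (U.domRestrict Arr.tgt)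

/-- Compact open bisections. -/
structure IsCompactOpenBisection [TopologicalSpace X] [TopologicalSpace (Arr X)]
    (U : Set (Arr X)) : Prop where
  isCompact : IsCompact U
  isOpen : IsOpen U
  isBisection : IsBisection U

/-- The factorizations `γ = αβ`. -/
def factorizations (γ : Arr X) : Set (Arr X × Arr X) :=
  {p | ∃ h : p.1.src = p.2.tgt, comp p.1 p.2 h = γ}

/-- The convolution `(f * g)(γ) = ∑_{αβ = γ} f(α) g(β)`. -/
noncomputable def conv {S : Type w} [CommSemiring S] (f g : Arr X → S) : Arr X → S :=
  fun γ => ∑ᶠ p : factorizations γ, f p.1.1 * g p.1.2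

/-- The characteristic function of a set. -/
noncomputable def chi (S : Type w) [CommSemiring S] (U : Set (Arr X)) : Arr X → S :=
  U.indicator 1

/-- The product `UV` of sets of morphisms. -/
def setMul (U V : Set (Arr X)) : Set (Arr X) :=
  {γ | ∃ α ∈ U, ∃ β ∈ V, ∃ h : α.src = β.tgt, comp α β h = γ}

end Notions

/-- The Steinberg algebra `A_S(G)` as a submodule of the module of functions `G → S`. -/
def steinbergAlgebra (S : Type w) (X : Type u) [CommSemiring S] [Groupoid.{v} X]
    [TopologicalSpace X] [TopologicalSpace (Arr X)] : Submodule S (Arr X → S) :=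
  Submodule.span S {f | ∃ U : Set (Arr X), IsCompactOpenBisection U ∧ f = chi S U}

section Algebra

variable {S : Type w} {X : Type u} [CommSemiring S] [Groupoid.{v} X]

lemma factorizations_fst_injective (γ : Arr X) :
    Function.Injective fun p : factorizations γ => p.1.1 := by
  rintro ⟨⟨α, β⟩, h, rfl⟩ ⟨⟨α', β'⟩, h', e⟩ hα
  dsimp only at hα
  subst hα
  have := inv_comp_cancel α β h
  dsimp only at e h h'
  have e2 : β' = β := by
    rw [← inv_comp_cancel α β' h', ← inv_comp_cancel α β h]
    congr 1
  subst e2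
  rfl

lemma zero_conv (g : Arr X → S) : conv 0 g = 0 := by
  funext γ
  simp [conv]

lemma conv_zero (f : Arr X → S) : conv f 0 = 0 := by
  funext γ
  simp [conv]

lemma setMul_assoc (U V W : Set (Arr X)) :
    setMul (setMul U V) W = setMul U (setMul V W) := by
  ext γ
  constructor
  · rintro ⟨_, ⟨α, hα, β, hβ, h, rfl⟩, δ, hδ, h', rfl⟩
    exact ⟨α, hα, comp β δ h', ⟨β, hβ, δ, hδ, h', rfl⟩, h, (comp_assoc α β δ h h').symm⟩
  · rintro ⟨α, hα, _, ⟨β, hβ, δ, hδ, h', rfl⟩, h, rfl⟩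
    exact ⟨comp α β h, ⟨α, hα, β, hβ, h, rfl⟩, δ, hδ, h', comp_assoc α β δ h h'⟩

variable [TopologicalSpace X] [TopologicalSpace (Arr X)]

lemma IsBisection.injOn_src {U : Set (Arr X)} (hU : IsBisection U) : Set.InjOn Arr.src U :=
  Set.injOn_iff_injective.2 hU.1.injective

lemma IsBisection.injOn_tgt {U : Set (Arr X)} (hU : IsBisection U) : Set.InjOn Arr.tgt U :=
  Set.injOn_iff_injective.2 hU.2.injective

lemma isBisection_of_injOn [EtaleGroupoid X] {U : Set (Arr X)} (hU : IsOpen U)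
    (h₁ : Set.InjOn Arr.src U) (h₂ : Set.InjOn Arr.tgt U) : IsBisection U := by
  have key : ∀ φ : Arr X → X, IsLocalHomeomorph φ → Set.InjOn φ U →
      IsEmbedding (U.domRestrict φ) := fun φ hφ hi =>
    (IsOpenEmbedding.of_continuous_injective_isOpenMap
      (hφ.continuous.comp continuous_subtype_val) (Set.injOn_iff_injective.1 hi)
      (hφ.isOpenMap.comp hU.isOpenMap_subtype_val)).isEmbedding
  exact ⟨key _ EtaleGroupoid.isLocalHomeomorph_src h₁,
    key _ EtaleGroupoid.isLocalHomeomorph_tgt h₂⟩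

lemma isOpen_setMul [EtaleGroupoid X] {U V : Set (Arr X)} (hU : IsOpen U) (hV : IsOpen V) :
    IsOpen (setMul U V) := by
  -- the continuous map `(α, γ) ↦ α⁻¹γ`
  let m : {p : Arr X × Arr X // p.1.tgt = p.2.tgt} → Arr X := fun p => comp p.1.1.inv p.1.2 p.2
  have hm : Continuous m :=
    (TopologicalGroupoid.continuous_comp (X := X)).comp
      (Continuous.subtype_mk (f := fun p : {p : Arr X × Arr X // p.1.tgt = p.2.tgt} =>
          (p.1.1.inv, p.1.2))
        (((TopologicalGroupoid.continuous_inv (X := X)).comp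
          (continuous_fst.comp continuous_subtype_val)).prodMk
            (continuous_snd.comp continuous_subtype_val)) fun p => p.2)
  obtain ⟨W, hW, hWm⟩ := isOpen_induced_iff.1 (hV.preimage hm)
  rw [isOpen_iff_mem_nhds]
  rintro _ ⟨α, hα, β, hβ, h, rfl⟩
  have hmem : (⟨(α, comp α β h), rfl⟩ : {p : Arr X × Arr X // p.1.tgt = p.2.tgt}) ∈ m ⁻¹' V := by
    change comp α.inv (comp α β h) rfl ∈ V
    rwa [inv_comp_cancel]
  rw [← hWm] at hmem
  obtain ⟨A, C, hA, hC, hαA, hγC, hAC⟩ := isOpen_prod_iff.1 hW _ _ hmem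
  have hT : IsOpen (Arr.tgt '' (A ∩ U)) :=
    (EtaleGroupoid.isLocalHomeomorph_tgt (X := X)).isOpenMap _ (hA.inter hU)
  refine Filter.mem_of_superset ((hC.inter (hT.preimage
    (TopologicalGroupoid.continuous_tgt (X := X)))).mem_nhds ⟨hγC, α, ⟨hαA, hα⟩, rfl⟩) ?_
  rintro γ ⟨hγ, α', ⟨hα'A, hα'⟩, e⟩
  have : (⟨(α', γ), e⟩ : {p : Arr X × Arr X // p.1.tgt = p.2.tgt}) ∈ m ⁻¹' V := by
    rw [← hWm]
    exact hAC ⟨hα'A, hγ⟩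
  exact ⟨α', hα', _, this, rfl, comp_inv_cancel α' γ e⟩

lemma isCompact_setMul [EtaleGroupoid X] {U V : Set (Arr X)} (hU : IsCompact U)
    (hV : IsCompact V) : IsCompact (setMul U V) := by
  have : T2Space X := EtaleGroupoid.t2Space
  have hclosed : IsClosed {p : Arr X × Arr X | p.1.src = p.2.tgt} :=
    isClosed_eq ((TopologicalGroupoid.continuous_src (X := X)).comp continuous_fst)
      ((TopologicalGroupoid.continuous_tgt (X := X)).comp continuous_snd)
  have hK := (hclosed.isClosedEmbedding_subtypeVal.isCompact_preimage (hU.prod hV)).image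
    (TopologicalGroupoid.continuous_comp (X := X))
  convert hK using 1
  ext γ
  constructor
  · rintro ⟨α, hα, β, hβ, h, rfl⟩
    exact ⟨⟨(α, β), h⟩, ⟨hα, hβ⟩, rfl⟩
  · rintro ⟨⟨⟨α, β⟩, h⟩, ⟨hα, hβ⟩, rfl⟩
    exact ⟨α, hα, β, hβ, h, rfl⟩

lemma IsCompactOpenBisection.setMul [EtaleGroupoid X] {U V : Set (Arr X)}
    (hU : IsCompactOpenBisection U) (hV : IsCompactOpenBisection V) :
    IsCompactOpenBisection (setMul U V) := by
  have ho := isOpen_setMul hU.isOpen hV.isOpen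
  refine ⟨isCompact_setMul hU.isCompact hV.isCompact, ho, isBisection_of_injOn ho ?_ ?_⟩
  · rintro _ ⟨α, hα, β, hβ, h, rfl⟩ _ ⟨α', hα', β', hβ', h', rfl⟩ e
    obtain rfl := hV.isBisection.injOn_src hβ hβ' e
    obtain rfl := hU.isBisection.injOn_src hα hα' (h.trans h'.symm)
    rfl
  · rintro _ ⟨α, hα, β, hβ, h, rfl⟩ _ ⟨α', hα', β', hβ', h', rfl⟩ e
    obtain rfl := hU.isBisection.injOn_tgt hα hα' e
    obtain rfl := hV.isBisection.injOn_tgt hβ hβ' (h.symm.trans h')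
    rfl

lemma chi_mem {U : Set (Arr X)} (hU : IsCompactOpenBisection U) :
    chi S U ∈ steinbergAlgebra S X :=
  Submodule.subset_span ⟨U, hU, rfl⟩

lemma finite_support_tgt {f : Arr X → S} (hf : f ∈ steinbergAlgebra S X) (y : X) :
    {α | f α ≠ 0 ∧ α.tgt = y}.Finite := by
  induction hf using Submodule.span_induction with
  | mem f hf =>
    obtain ⟨U, hU, rfl⟩ := hf
    refine Set.Subsingleton.finite ?_
    rintro α ⟨hα, hαy⟩ β ⟨hβ, hβy⟩
    exact hU.isBisection.injOn_tgt (Set.mem_of_indicator_ne_zero hα)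
      (Set.mem_of_indicator_ne_zero hβ) (hαy.trans hβy.symm)
  | zero => simp
  | add f g _ _ hf hg =>
    refine (hf.union hg).subset ?_
    rintro α ⟨hα, hy⟩
    by_cases h : f α = 0
    · exact Or.inr ⟨fun h' => hα (by simp [h, h']), hy⟩
    · exact Or.inl ⟨h, hy⟩
  | smul a f _ hf =>
    refine hf.subset ?_
    rintro α ⟨hα, hy⟩
    exact ⟨fun h' => hα (by simp [h']), hy⟩

lemma finite_support_conv {f : Arr X → S} (hf : f ∈ steinbergAlgebra S X) (g : Arr X → S)
    (γ : Arr X) :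
    (Function.support fun p : factorizations γ => f p.1.1 * g p.1.2).Finite := by
  refine Set.Finite.of_finite_image (f := fun p : factorizations γ => p.1.1)
    ((finite_support_tgt hf γ.tgt).subset ?_) (factorizations_fst_injective γ).injOn
  rintro _ ⟨⟨⟨α, β⟩, h, rfl⟩, hp, rfl⟩
  exact ⟨left_ne_zero_of_mul hp, rfl⟩

lemma add_conv {f f' : Arr X → S} (hf : f ∈ steinbergAlgebra S X)
    (hf' : f' ∈ steinbergAlgebra S X) (g : Arr X → S) :
    conv (f + f') g = conv f g + conv f' g := by
  funext γ
  simp only [conv, Pi.add_apply, add_mul]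
  exact finsum_add_distrib (finite_support_conv hf g γ) (finite_support_conv hf' g γ)

lemma conv_add {f : Arr X → S} (hf : f ∈ steinbergAlgebra S X) (g g' : Arr X → S) :
    conv f (g + g') = conv f g + conv f g' := by
  funext γ
  simp only [conv, Pi.add_apply, mul_add]
  exact finsum_add_distrib (finite_support_conv hf g γ) (finite_support_conv hf g' γ)

lemma smul_conv (a : S) {f : Arr X → S} (hf : f ∈ steinbergAlgebra S X) (g : Arr X → S) :
    conv (a • f) g = a • conv f g := by
  funext γ
  simp only [conv, Pi.smul_apply, smul_eq_mul, mul_assoc]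
  exact (mul_finsum' _ a (finite_support_conv hf g γ)).symm

lemma conv_smul (a : S) {f : Arr X → S} (hf : f ∈ steinbergAlgebra S X) (g : Arr X → S) :
    conv f (a • g) = a • conv f g := by
  funext γ
  simp only [conv, Pi.smul_apply, smul_eq_mul, mul_left_comm _ a]
  exact (mul_finsum' _ a (finite_support_conv hf g γ)).symm

lemma chi_conv_chi {U V : Set (Arr X)} (hU : IsBisection U) :
    conv (chi S U) (chi S V) = chi S (setMul U V) := by
  classical
  funext γ
  by_cases hγ : γ ∈ setMul U V
  · obtain ⟨α, hα, β, hβ, h, rfl⟩ := hγ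
    rw [conv, finsum_eq_single _ (⟨(α, β), h, rfl⟩ : factorizations (comp α β h))]
    · have : comp α β h ∈ setMul U V := ⟨α, hα, β, hβ, h, rfl⟩
      simp [chi, hα, hβ, this]
    · intro p hp
      by_contra hne
      refine hp (factorizations_fst_injective _ ?_)
      have h1 : p.1.1 ∈ U := Set.mem_of_indicator_ne_zero (left_ne_zero_of_mul hne)
      obtain ⟨⟨α', β'⟩, h', e⟩ := p
      have e' := congrArg Arr.tgt e
      exact hU.injOn_tgt h1 hα e'
  · rw [conv, show chi S (setMul U V) γ = 0 from Set.indicator_of_notMem hγ _]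
    refine (finsum_congr fun p => ?_).trans finsum_zero
    by_contra hne
    obtain ⟨⟨α, β⟩, h, e⟩ := p
    exact hγ ⟨α, Set.mem_of_indicator_ne_zero (left_ne_zero_of_mul hne), β,
      Set.mem_of_indicator_ne_zero (right_ne_zero_of_mul hne), h, e⟩

lemma conv_mem [EtaleGroupoid X] {f g : Arr X → S} (hf : f ∈ steinbergAlgebra S X)
    (hg : g ∈ steinbergAlgebra S X) : conv f g ∈ steinbergAlgebra S X := by
  induction hf using Submodule.span_induction with
  | mem f hf =>
    obtain ⟨U, hU, rfl⟩ := hf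
    induction hg using Submodule.span_induction with
    | mem g hg =>
      obtain ⟨V, hV, rfl⟩ := hg
      rw [chi_conv_chi hU.isBisection]
      exact chi_mem (hU.setMul hV)
    | zero => rw [conv_zero]; exact zero_mem _
    | add g g' _ _ hg hg' => rw [conv_add (chi_mem hU)]; exact add_mem hg hg'
    | smul a g _ hg => rw [conv_smul a (chi_mem hU)]; exact Submodule.smul_mem _ a hg
  | zero => rw [zero_conv]; exact zero_mem _
  | add f f' hfm hfm' hf hf' => rw [add_conv hfm hfm']; exact add_mem hf hf'
  | smul a f hfm hf => rw [smul_conv a hfm]; exact Submodule.smul_mem _ a hf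

lemma conv_assoc [EtaleGroupoid X] {f g k : Arr X → S} (hf : f ∈ steinbergAlgebra S X)
    (hg : g ∈ steinbergAlgebra S X) (hk : k ∈ steinbergAlgebra S X) :
    conv (conv f g) k = conv f (conv g k) := by
  induction hf using Submodule.span_induction with
  | mem f hf =>
    obtain ⟨U, hU, rfl⟩ := hf
    induction hg using Submodule.span_induction with
    | mem g hg =>
      obtain ⟨V, hV, rfl⟩ := hg
      have hUV : chi S (setMul U V) ∈ steinbergAlgebra S X := chi_mem (hU.setMul hV)
      rw [chi_conv_chi hU.isBisection]
      induction hk using Submodule.span_induction with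
      | mem k hk =>
        obtain ⟨W, hW, rfl⟩ := hk
        rw [chi_conv_chi (hU.setMul hV).isBisection, chi_conv_chi hV.isBisection,
          chi_conv_chi hU.isBisection, setMul_assoc]
      | zero => simp only [conv_zero]
      | add k k' _ _ hk hk' =>
        rw [conv_add hUV, conv_add (chi_mem hV), conv_add (chi_mem hU), hk, hk']
      | smul a k _ hk =>
        rw [conv_smul a hUV, conv_smul a (chi_mem hV), conv_smul a (chi_mem hU), hk]
    | zero => simp only [conv_zero, zero_conv]
    | add g g' hgm hgm' hg hg' =>
      rw [conv_add (chi_mem hU), add_conv (conv_mem (chi_mem hU) hgm)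
        (conv_mem (chi_mem hU) hgm'), add_conv hgm hgm', conv_add (chi_mem hU), hg, hg']
    | smul a g hgm hg =>
      rw [conv_smul a (chi_mem hU), smul_conv a (conv_mem (chi_mem hU) hgm),
        smul_conv a hgm, conv_smul a (chi_mem hU), hg]
  | zero => simp only [zero_conv]
  | add f f' hfm hfm' hf hf' =>
    rw [add_conv hfm hfm', add_conv (conv_mem hfm hg) (conv_mem hfm' hg),
      add_conv hfm hfm', hf, hf']
  | smul a f hfm hf =>
    rw [smul_conv a hfm, smul_conv a (conv_mem hfm hg), smul_conv a hfm, hf]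

variable (S X) in
/-- The Steinberg algebra is a hemiring under pointwise addition and convolution. -/
noncomputable instance [EtaleGroupoid X] : NonUnitalSemiring (steinbergAlgebra S X) where
  __ := (inferInstance : AddCommMonoid (steinbergAlgebra S X))
  mul f g := ⟨conv f.1 g.1, conv_mem f.2 g.2⟩
  left_distrib f g k := Subtype.ext (conv_add f.2 g.1 k.1)
  right_distrib f g k := Subtype.ext (add_conv f.2 g.2 k.1)
  zero_mul f := Subtype.ext (zero_conv f.1)
  mul_zero f := Subtype.ext (conv_zero f.1)
  mul_assoc f g k := Subtype.ext (conv_assoc f.2 g.2 k.2)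

variable (S X) in
instance [EtaleGroupoid X] : IsScalarTower S (steinbergAlgebra S X) (steinbergAlgebra S X) where
  smul_assoc a f g := Subtype.ext (smul_conv a f.2 g.1)

variable (S X) in
instance [EtaleGroupoid X] : SMulCommClass S (steinbergAlgebra S X) (steinbergAlgebra S X) where
  smul_comm a f g := Subtype.ext (conv_smul a f.2 g.1).symm

end Algebra

/-- A hemiring is congruence-simple if its only congruences are the diagonal and the full one. -/
def IsCongruenceSimple (R : Type w) [NonUnitalSemiring R] : Prop :=
  ∀ c : RingCon R, (∀ x y, c x y → x = y) ∨ (∀ x y, c x y)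

/-- The underlying set `{0, 1}` of the Boolean semifield. -/
inductive BooleanSemifield : Type
  | zero
  | one

namespace BooleanSemifield

/-- Disjunction. -/
def or : BooleanSemifield → BooleanSemifield → BooleanSemifield
  | zero, b => b
  | one, _ => one

/-- Conjunction. -/
def and : BooleanSemifield → BooleanSemifield → BooleanSemifield
  | zero, _ => zero
  | one, b => b

instance : Zero BooleanSemifield := ⟨zero⟩
instance : One BooleanSemifield := ⟨one⟩
instance : Add BooleanSemifield := ⟨or⟩
instance : Mul BooleanSemifield := ⟨and⟩

instance : CommSemiring BooleanSemifield where
  add_assoc := by rintro (_ | _) (_ | _) (_ | _) <;> rfl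
  zero_add := by rintro (_ | _) <;> rfl
  add_zero := by rintro (_ | _) <;> rfl
  add_comm := by rintro (_ | _) (_ | _) <;> rfl
  mul_assoc := by rintro (_ | _) (_ | _) (_ | _) <;> rfl
  one_mul := by rintro (_ | _) <;> rfl
  mul_one := by rintro (_ | _) <;> rfl
  mul_comm := by rintro (_ | _) (_ | _) <;> rfl
  left_distrib := by rintro (_ | _) (_ | _) (_ | _) <;> rfl
  right_distrib := by rintro (_ | _) (_ | _) (_ | _) <;> rfl
  zero_mul := by rintro (_ | _) <;> rfl
  mul_zero := by rintro (_ | _) <;> rfl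
  nsmul := nsmulRec

end BooleanSemifield

end Steinberg

/-!
Congruences on `A_S(G)` are produced as kernels of homomorphisms, which under congruence-simplicity
are injective or zero. A congruence on `S` induces a homomorphism `A_S(G) → A_{S/c}(G)`, so `S` is
congruence-simple, and the Bourne congruences of its ideals then force it to be a field or `𝔹`.
For an invariant set `Y` of units, `A_S(G)` acts on the functions on `Y`, and a bisection `U` inside
the isotropy acts as multiplication by the indicator of `s(U)`. Hence, if `Y` is nonempty, such a
`U` is determined by `s(U) ∩ Y`. With `Y` the complement of an open invariant set this is
minimality, with `Y` the whole unit space it is effectiveness.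
-/

namespace Steinberg

open CategoryTheory Topology Arr

universe v u

section CongruenceSimple

theorem IsCongruenceSimple.injective_or_eq_zero {R : Type*} [NonUnitalSemiring R]
    (hR : IsCongruenceSimple R) {T F : Type*} [NonUnitalNonAssocSemiring T] [FunLike F R T]
    [NonUnitalRingHomClass F R T] (f : F) : Function.Injective f ∨ ∀ x, f x = 0 :=
  (hR (RingCon.comap ⊥ f)).imp (fun h x y => h x y)
    fun h x => (h x 0 : f x = f 0).trans (map_zero f)

variable {S : Type*} [CommSemiring S]

/-- The Bourne congruence of an ideal `I`: it identifies `x` and `y` if they become equal after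
adding elements of `I`. It replaces congruence modulo `I`, as subtraction is not available. -/
def bourneCon (I : Ideal S) : RingCon S where
  r x y := ∃ i ∈ I, ∃ j ∈ I, x + i = y + j
  iseqv := by
    refine ⟨fun x => ⟨0, I.zero_mem, 0, I.zero_mem, rfl⟩,
      fun ⟨i, hi, j, hj, h⟩ => ⟨j, hj, i, hi, h.symm⟩, ?_⟩
    rintro x y z ⟨i, hi, j, hj, h⟩ ⟨k, hk, l, hl, h'⟩
    refine ⟨i + k, add_mem hi hk, l + j, add_mem hl hj, ?_⟩
    rw [← add_assoc, h, add_right_comm, h', add_assoc]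
  add' := by
    rintro x y z w ⟨i, hi, j, hj, h⟩ ⟨k, hk, l, hl, h'⟩
    refine ⟨i + k, add_mem hi hk, j + l, add_mem hj hl, ?_⟩
    rw [add_add_add_comm, h, h', add_add_add_comm]
  mul' := by
    rintro x y z w ⟨i, hi, j, hj, h⟩ ⟨k, hk, l, hl, h'⟩
    refine ⟨x * k + i * (z + k), add_mem (I.mul_mem_left _ hk) (I.mul_mem_right _ hi),
      y * l + j * (w + l), add_mem (I.mul_mem_left _ hl) (I.mul_mem_right _ hj), ?_⟩
    calc x * z + (x * k + i * (z + k)) = (x + i) * (z + k) := by ring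
      _ = (y + j) * (w + l) := by rw [h, h']
      _ = y * w + (y * l + j * (w + l)) := by ring

theorem IsCongruenceSimple.exists_one_add_eq (hS : IsCongruenceSimple S) {I : Ideal S}
    (hI : I ≠ ⊥) : ∃ i ∈ I, ∃ j ∈ I, 1 + i = j := by
  obtain ⟨a, ha, ha0⟩ := I.ne_bot_iff.1 hI
  rcases hS (bourneCon I) with hdiag | hfull
  · exact absurd (hdiag a 0 ⟨0, I.zero_mem, a, ha, by rw [add_zero, zero_add]⟩) ha0
  · obtain ⟨i, hi, j, hj, h⟩ := hfull 1 0
    exact ⟨i, hi, j, hj, h.trans (zero_add j)⟩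

theorem IsCongruenceSimple.noZeroDivisors (hS : IsCongruenceSimple S) : NoZeroDivisors S where
  eq_zero_or_eq_zero_of_mul_eq_zero {a b} hab := by
    by_contra! ⟨ha, hb⟩
    let annihilator : Ideal S := LinearMap.ker (LinearMap.mulLeft S a)
    obtain ⟨i, hi, j, hj, h⟩ := hS.exists_one_add_eq (I := annihilator)
      (annihilator.ne_bot_iff.2 ⟨b, hab, hb⟩)
    have hai : a * i = 0 := hi
    have haj : a * j = 0 := hj
    refine ha ?_
    calc a = a * (1 + i) := by rw [mul_add, mul_one, hai, add_zero]
      _ = 0 := by rw [h, haj]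

theorem IsCongruenceSimple.isAddUnit_one_or_forall_eq_zero (hS : IsCongruenceSimple S) :
    IsAddUnit (1 : S) ∨ ∀ a b : S, a + b = 0 → a = 0 := by
  refine or_iff_not_imp_right.2 fun hsum => ?_
  push Not at hsum
  obtain ⟨a, b, hab, ha⟩ := hsum
  let addUnits : Ideal S :=
    { IsAddUnit.addSubmonoid S with smul_mem' := fun c _ h => h.mul_left c }
  obtain ⟨i, -, j, hj, h⟩ := hS.exists_one_add_eq (I := addUnits)
    (addUnits.ne_bot_iff.2 ⟨a, IsAddUnit.of_add_eq_zero b hab, ha⟩)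
  exact isAddUnit_of_add_isAddUnit_left (h ▸ hj : IsAddUnit (1 + i))

theorem IsCongruenceSimple.isField [Nontrivial S] (hS : IsCongruenceSimple S)
    (hneg : IsAddUnit (1 : S)) : IsField S where
  exists_pair_ne := exists_pair_ne S
  mul_comm := mul_comm
  mul_inv_cancel {a} ha := by
    obtain ⟨b, hb⟩ := hneg.exists_neg
    obtain ⟨i, hi, j, hj, h⟩ := hS.exists_one_add_eq (I := Ideal.span {a})
      (by rwa [Ne, Ideal.span_singleton_eq_bot])
    obtain ⟨x, rfl⟩ := Ideal.mem_span_singleton.1 hi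
    obtain ⟨y, rfl⟩ := Ideal.mem_span_singleton.1 hj
    refine ⟨y + b * x, ?_⟩
    calc a * (y + b * x) = a * y + b * (a * x) := by ring
      _ = 1 + (1 + b) * (a * x) := by rw [← h]; ring
      _ = 1 := by rw [hb, zero_mul, add_zero]

open scoped Classical in
/-- The support homomorphism from a semiring without zero sums and zero divisors to the Boolean
semifield, which sends precisely `0` to `0`. -/
noncomputable def BooleanSemifield.supportHom [Nontrivial S] [NoZeroDivisors S]
    (hsum : ∀ a b : S, a + b = 0 → a = 0) : S →+* BooleanSemifield where
  toFun a := if a = 0 then 0 else 1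
  map_zero' := if_pos rfl
  map_one' := if_neg one_ne_zero
  map_add' a b := by
    by_cases ha : a = 0
    · simp [ha]
    · rw [if_neg ha, if_neg fun h => ha (hsum a b h)]
      rfl
  map_mul' a b := by
    by_cases ha : a = 0 <;> by_cases hb : b = 0 <;> simp [ha, hb]

instance : Nontrivial BooleanSemifield := ⟨0, 1, nofun⟩

theorem IsCongruenceSimple.nonempty_ringEquiv_booleanSemifield [Nontrivial S]
    (hS : IsCongruenceSimple S) (hsum : ∀ a b : S, a + b = 0 → a = 0) :
    Nonempty (S ≃+* BooleanSemifield) := by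
  have := hS.noZeroDivisors
  let supp := BooleanSemifield.supportHom hsum
  refine ⟨RingEquiv.ofBijective supp ⟨(hS.injective_or_eq_zero supp).resolve_right fun h => ?_, ?_⟩⟩
  · exact one_ne_zero ((map_one supp).symm.trans (h 1))
  · rintro (_ | _)
    exacts [⟨0, map_zero supp⟩, ⟨1, map_one supp⟩]

theorem IsCongruenceSimple.isField_or_nonempty_ringEquiv [Nontrivial S]
    (hS : IsCongruenceSimple S) :
    (IsField S ∧ IsAddUnit (1 : S)) ∨ Nonempty (S ≃+* BooleanSemifield) :=
  hS.isAddUnit_one_or_forall_eq_zero.imp (fun hneg => ⟨hS.isField hneg, hneg⟩)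
    hS.nonempty_ringEquiv_booleanSemifield

theorem exists_field_toSemifield_eq {K : Type*} [Semifield K] (hneg : IsAddUnit (1 : K)) :
    ∃ F : Field K, F.toSemifield = ‹Semifield K› := by
  obtain ⟨b, hb⟩ := hneg.exists_neg
  let _ : Neg K := ⟨fun a => b * a⟩
  let F : Field K :=
    { ‹Semifield K› with
      zsmul := zsmulRec
      neg_add_cancel := fun a => by
        change b * a + a = 0
        rw [← add_one_mul, add_comm, hb, zero_mul]
      qsmul := _
      qsmul_def := fun _ _ => rfl }
  exact ⟨F, rfl⟩

end CongruenceSimple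

section Topology

variable {X : Type u} [Groupoid.{v} X]

lemma image_unit_subset_iso (K : Set X) : unit '' K ⊆ iso X := by
  rintro _ ⟨x, -, rfl⟩
  rfl

lemma image_src_image_unit (K : Set X) : src '' (unit '' K) = K := by
  simp only [Set.image_image, src_unit, Set.image_id']

variable [TopologicalSpace X] [TopologicalSpace (Arr X)]

lemma isOpenMap_unit [EtaleGroupoid X] : IsOpenMap (unit : X → Arr X) :=
  (IsLocalHomeomorph.of_comp (g := src) (f := unit) (Homeomorph.refl X).isLocalHomeomorph
    EtaleGroupoid.isLocalHomeomorph_src TopologicalGroupoid.continuous_unit).isOpenMap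

lemma IsCompactOpenBisection.image_unit [EtaleGroupoid X] {K : Set X} (hK : IsCompact K)
    (hKo : IsOpen K) : IsCompactOpenBisection (unit '' K) where
  isCompact := hK.image TopologicalGroupoid.continuous_unit
  isOpen := isOpenMap_unit _ hKo
  isBisection := isBisection_of_injOn (isOpenMap_unit _ hKo)
    (Set.InjOn.image_of_comp (g := src) (f := unit) (Set.injOn_id K))
    (Set.InjOn.image_of_comp (g := tgt) (f := unit) (Set.injOn_id K))

lemma IsCompactOpenBisection.image_unit_image_src [EtaleGroupoid X] {U : Set (Arr X)}
    (hU : IsCompactOpenBisection U) : IsCompactOpenBisection (unit '' (src '' U)) :=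
  image_unit (hU.isCompact.image TopologicalGroupoid.continuous_src)
    (EtaleGroupoid.isLocalHomeomorph_src.isOpenMap _ hU.isOpen)

lemma exists_isCompact_isOpen_subset [AmpleGroupoid X] {D : Set X} (hD : IsOpen D) {x : X}
    (hx : x ∈ D) : ∃ K : Set X, IsCompact K ∧ IsOpen K ∧ x ∈ K ∧ K ⊆ D := by
  have : T2Space X := EtaleGroupoid.t2Space
  have : LocallyCompactSpace X := EtaleGroupoid.locallyCompactSpace
  have : TotallyDisconnectedSpace X := AmpleGroupoid.totallyDisconnectedSpace
  obtain ⟨C, hC, hxC, hCD⟩ := exists_compact_subset hD hx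
  obtain ⟨K, hK, hxK, hKC⟩ := loc_compact_Haus_tot_disc_of_zero_dim.exists_subset_of_mem_open
    hxC isOpen_interior
  have hKC' : K ⊆ C := hKC.trans interior_subset
  exact ⟨K, hC.of_isClosed_subset hK.isClosed hKC', hK.isOpen, hxK, hKC'.trans hCD⟩

lemma exists_isCompactOpenBisection_subset [AmpleGroupoid X] {W : Set (Arr X)} (hW : IsOpen W)
    {γ : Arr X} (hγ : γ ∈ W) : ∃ U : Set (Arr X), IsCompactOpenBisection U ∧ γ ∈ U ∧ U ⊆ W := by
  obtain ⟨e, hγe, hsrc⟩ := EtaleGroupoid.isLocalHomeomorph_src (X := X) γ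
  obtain ⟨e', hγe', htgt⟩ := EtaleGroupoid.isLocalHomeomorph_tgt (X := X) γ
  obtain ⟨K, hK, hKo, hγK, hKe⟩ := exists_isCompact_isOpen_subset
    (e.isOpen_inter_preimage_symm (hW.inter e'.open_source)) (x := e γ)
    ⟨e.map_source hγe, by simpa only [Set.mem_preimage, e.left_inv hγe] using ⟨hγ, hγe'⟩⟩
  have hKt : K ⊆ e.target := fun x hx => (hKe hx).1
  have hUW : e.symm '' K ⊆ W ∩ e'.source := Set.image_subset_iff.2 fun x hx => (hKe hx).2
  have hUe : e.symm '' K ⊆ e.source := (Set.image_mono hKt).trans e.symm_image_target_eq_source.le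
  have hUo : IsOpen (e.symm '' K) := e.isOpen_image_symm_of_subset_target hKo hKt
  refine ⟨e.symm '' K, ⟨hK.image_of_continuousOn (e.continuousOn_symm.mono hKt), hUo,
    isBisection_of_injOn hUo ?_ ?_⟩, ⟨e γ, hγK, e.left_inv hγe⟩, hUW.trans Set.inter_subset_left⟩
  · exact hsrc ▸ e.injOn.mono hUe
  · exact htgt ▸ e'.injOn.mono (hUW.trans Set.inter_subset_right)

end Topology

section Coefficients

variable {S : Type*} {X : Type u} [CommSemiring S] [Groupoid.{v} X]
  [TopologicalSpace X] [TopologicalSpace (Arr X)]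

variable (S) in
/-- The characteristic function of a compact open bisection as an element of the Steinberg
algebra. -/
noncomputable def ofBisection {U : Set (Arr X)} (hU : IsCompactOpenBisection U) :
    steinbergAlgebra S X :=
  ⟨chi S U, chi_mem hU⟩

lemma ofBisection_apply_of_mem {U : Set (Arr X)} (hU : IsCompactOpenBisection U) {γ : Arr X}
    (hγ : γ ∈ U) : (ofBisection S hU).1 γ = 1 :=
  Set.indicator_of_mem hγ _

lemma eq_of_ofBisection_eq [Nontrivial S] {U V : Set (Arr X)} {hU : IsCompactOpenBisection U}
    {hV : IsCompactOpenBisection V} (h : ofBisection S hU = ofBisection S hV) : U = V :=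
  Set.indicator_one_inj S (congrArg Subtype.val h)

lemma ofBisection_mul_ofBisection [EtaleGroupoid X] {U V : Set (Arr X)}
    (hU : IsCompactOpenBisection U) (hV : IsCompactOpenBisection V) :
    ofBisection S hU * ofBisection S hV = ofBisection S (hU.setMul hV) :=
  Subtype.ext (chi_conv_chi hU.isBisection)

lemma linearMap_ext {M : Type*} [AddCommMonoid M] [Module S M]
    {f g : steinbergAlgebra S X →ₗ[S] M}
    (h : ∀ (U : Set (Arr X)) (hU : IsCompactOpenBisection U),
      f (ofBisection S hU) = g (ofBisection S hU)) : f = g := by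
  refine LinearMap.ext_on Submodule.span_span_coe_preimage ?_
  rintro ⟨_, hf⟩ ⟨U, hU, rfl⟩
  exact h U hU

lemma ringHom_comp_mem {T : Type*} [CommSemiring T] (h : S →+* T) {f : Arr X → S}
    (hf : f ∈ steinbergAlgebra S X) : h ∘ f ∈ steinbergAlgebra T X := by
  induction hf using Submodule.span_induction with
  | mem f hf =>
    obtain ⟨U, hU, rfl⟩ := hf
    have hchi : h ∘ chi S U = chi T U := by
      rw [chi, ← Set.indicator_comp_of_zero (map_zero h)]
      exact congrArg U.indicator (funext fun _ => map_one h)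
    exact hchi ▸ chi_mem hU
  | zero => exact (funext fun _ => map_zero h : h ∘ (0 : Arr X → S) = 0) ▸ zero_mem _
  | add f g _ _ hf hg =>
    exact (funext fun _ => map_add h _ _ : h ∘ (f + g) = h ∘ f + h ∘ g) ▸ add_mem hf hg
  | smul a f _ hf =>
    exact (funext fun _ => map_mul h _ _ : h ∘ (a • f) = h a • h ∘ f) ▸
      Submodule.smul_mem _ (h a) hf

variable (X) in
/-- Change of coefficients: the homomorphism `A_S(G) → A_T(G)` given by composition with a
homomorphism `S → T`. -/
def steinbergAlgebra.map [EtaleGroupoid X] {T : Type*} [CommSemiring T] (h : S →+* T) :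
    steinbergAlgebra S X →ₙ+* steinbergAlgebra T X where
  toFun f := ⟨h ∘ f.1, ringHom_comp_mem h f.2⟩
  map_zero' := Subtype.ext (funext fun _ => map_zero h)
  map_add' _ _ := Subtype.ext (funext fun _ => map_add h _ _)
  map_mul' f g := Subtype.ext <| funext fun γ =>
    (h.toAddMonoidHom.map_finsum (finite_support_conv f.2 g.1 γ)).trans
      (finsum_congr fun _ => map_mul h _ _)

theorem IsCongruenceSimple.of_steinbergAlgebra [AmpleGroupoid X] [Nonempty X]
    (hsimple : IsCongruenceSimple (steinbergAlgebra S X)) : IsCongruenceSimple S := by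
  intro c
  obtain ⟨x⟩ := ‹Nonempty X›
  obtain ⟨K, hK, hKo, hxK, -⟩ := exists_isCompact_isOpen_subset isOpen_univ (Set.mem_univ x)
  let one_K := ofBisection S (.image_unit hK hKo)
  have hx : one_K.1 (unit x) = 1 := ofBisection_apply_of_mem _ (Set.mem_image_of_mem unit hxK)
  have eval_smul (a : S) : (a • one_K).1 (unit x) = a := (congrArg (a * ·) hx).trans (mul_one a)
  rcases hsimple.injective_or_eq_zero (steinbergAlgebra.map X c.mk') with hinj | hzero
  · refine .inl fun a b hab => ?_
    have hsmul : a • one_K = b • one_K := hinj <| Subtype.ext <| funext fun γ =>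
      c.eq.2 (c.mul hab (c.refl (one_K.1 γ)))
    rw [← eval_smul a, hsmul, eval_smul]
  · have hc (a : S) : c a 0 := by
      have := congrFun (congrArg Subtype.val (hzero (a • one_K))) (unit x)
      rw [← eval_smul a]
      exact c.eq.1 this
    exact .inr fun a b => c.trans (hc a) (c.symm (hc b))

end Coefficients

section UnitRepresentation

variable {X : Type u} [Groupoid.{v} X] {Y : Set X}

lemma IsInvariant.src_mem (hY : IsInvariant Y) (γ : Arr X) (hγ : γ.tgt ∈ Y) : γ.src ∈ Y :=
  hY γ.inv hγ

lemma IsInvariant.compl (hY : IsInvariant Y) : IsInvariant Yᶜ :=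
  fun γ hγ h => hγ (hY.src_mem γ h)

variable {S : Type*} [CommSemiring S]

/-- The action of functions on the groupoid on functions on an invariant set `Y` of units,
`(f φ)(y) = ∑_{r(α) = y} f(α) φ(s(α))`. -/
noncomputable def unitAct (hY : IsInvariant Y) (f : Arr X → S) (φ : Y → S) : Y → S :=
  fun y => ∑ᶠ α : {α : Arr X // α.tgt = y},
    f α * φ ⟨α.1.src, hY.src_mem α (Set.mem_of_eq_of_mem α.2 y.2)⟩

variable [TopologicalSpace X] [TopologicalSpace (Arr X)]

lemma finite_support_unitAct {f : Arr X → S} (hf : f ∈ steinbergAlgebra S X) (y : X)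
    (ψ : {α : Arr X // α.tgt = y} → S) :
    (Function.support fun α : {α : Arr X // α.tgt = y} => f α * ψ α).Finite := by
  refine .of_finite_image ((finite_support_tgt hf y).subset ?_) Subtype.val_injective.injOn
  rintro _ ⟨α, hα, rfl⟩
  exact ⟨left_ne_zero_of_mul hα, α.2⟩

variable (S) in
/-- The representation of the Steinberg algebra on functions on an invariant set of units, as a
linear map. It is multiplicative, see `unitRep`. -/
noncomputable def unitRepLinear (hY : IsInvariant Y) :
    steinbergAlgebra S X →ₗ[S] Module.End S (Y → S) :=
  LinearMap.mk₂ S (fun f φ => unitAct hY f.1 φ)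
    (fun f g φ => funext fun y => by
      simpa only [unitAct, Submodule.coe_add, Pi.add_apply, add_mul] using
        finsum_add_distrib (finite_support_unitAct f.2 y _) (finite_support_unitAct g.2 y _))
    (fun a f φ => funext fun y => by
      simpa only [unitAct, Submodule.coe_smul, Pi.smul_apply, smul_eq_mul, mul_assoc] using
        (mul_finsum' _ a (finite_support_unitAct f.2 y _)).symm)
    (fun f φ ψ => funext fun y => by
      simpa only [unitAct, Pi.add_apply, mul_add] using
        finsum_add_distrib (finite_support_unitAct f.2 y _) (finite_support_unitAct f.2 y _))
    (fun a f φ => funext fun y => by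
      simpa only [unitAct, Pi.smul_apply, smul_eq_mul, mul_left_comm _ a] using
        (mul_finsum' _ a (finite_support_unitAct f.2 y _)).symm)

lemma unitRepLinear_ofBisection_apply_tgt (hY : IsInvariant Y) {U : Set (Arr X)}
    (hU : IsCompactOpenBisection U) (φ : Y → S) {α : Arr X} (hα : α ∈ U) (hy : α.tgt ∈ Y) :
    unitRepLinear S hY (ofBisection S hU) φ ⟨α.tgt, hy⟩ = φ ⟨α.src, hY.src_mem α hy⟩ := by
  refine (finsum_eq_single _ ⟨α, rfl⟩ fun β hβ => ?_).trans ?_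
  · have hβU : β.1 ∉ U := fun h => hβ (Subtype.ext (hU.isBisection.injOn_tgt h hα β.2))
    exact mul_eq_zero_of_left (Set.indicator_of_notMem hβU _) _
  · rw [ofBisection_apply_of_mem hU hα, one_mul]

lemma unitRepLinear_ofBisection_apply_of_notMem (hY : IsInvariant Y) {U : Set (Arr X)}
    (hU : IsCompactOpenBisection U) (φ : Y → S) {y : Y} (hy : (y : X) ∉ tgt '' U) :
    unitRepLinear S hY (ofBisection S hU) φ y = 0 := by
  refine (finsum_congr fun α => ?_).trans finsum_zero
  exact mul_eq_zero_of_left (Set.indicator_of_notMem (fun h => hy ⟨α, h, α.2⟩) _) _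

lemma unitRepLinear_ofBisection_mul [EtaleGroupoid X] (hY : IsInvariant Y) {U V : Set (Arr X)}
    (hU : IsCompactOpenBisection U) (hV : IsCompactOpenBisection V) :
    unitRepLinear S hY (ofBisection S hU * ofBisection S hV) =
      unitRepLinear S hY (ofBisection S hU) * unitRepLinear S hY (ofBisection S hV) := by
  rw [ofBisection_mul_ofBisection]
  ext1 φ
  funext ⟨y, hy⟩
  rw [Module.End.mul_apply]
  by_cases hyU : y ∈ tgt '' U
  · obtain ⟨α, hα, rfl⟩ := hyU
    rw [unitRepLinear_ofBisection_apply_tgt hY hU _ hα hy]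
    by_cases hαV : α.src ∈ tgt '' V
    · obtain ⟨β, hβ, h⟩ := hαV
      have hαβ : comp α β h.symm ∈ setMul U V := ⟨α, hα, β, hβ, h.symm, rfl⟩
      simp only [← h]
      rw [unitRepLinear_ofBisection_apply_tgt hY hV φ hβ]
      exact unitRepLinear_ofBisection_apply_tgt hY (hU.setMul hV) φ hαβ hy
    · rw [unitRepLinear_ofBisection_apply_of_notMem hY hV φ hαV]
      refine unitRepLinear_ofBisection_apply_of_notMem hY _ φ ?_
      rintro ⟨_, ⟨α', hα', β, hβ, h, rfl⟩, htgt⟩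
      obtain rfl := hU.isBisection.injOn_tgt hα' hα htgt
      exact hαV ⟨β, hβ, h.symm⟩
  · rw [unitRepLinear_ofBisection_apply_of_notMem hY hU _ hyU]
    refine unitRepLinear_ofBisection_apply_of_notMem hY _ φ ?_
    rintro ⟨_, ⟨α, hα, β, -, h, rfl⟩, htgt⟩
    exact hyU ⟨α, hα, htgt⟩

lemma unitRepLinear_mul [EtaleGroupoid X] (hY : IsInvariant Y) (f g : steinbergAlgebra S X) :
    unitRepLinear S hY (f * g) = unitRepLinear S hY f * unitRepLinear S hY g := by
  have h : (LinearMap.mul S (steinbergAlgebra S X)).compr₂ (unitRepLinear S hY) =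
      (LinearMap.mul S (Module.End S (Y → S))).compl₁₂ (unitRepLinear S hY)
        (unitRepLinear S hY) :=
    linearMap_ext fun U hU => linearMap_ext fun V hV => unitRepLinear_ofBisection_mul hY hU hV
  exact LinearMap.congr_fun₂ h f g

variable (S) in
/-- The representation of the Steinberg algebra on functions on an invariant set of units. -/
noncomputable def unitRep [EtaleGroupoid X] (hY : IsInvariant Y) :
    steinbergAlgebra S X →ₙ+* Module.End S (Y → S) :=
  { (unitRepLinear S hY).toAddMonoidHom with map_mul' := unitRepLinear_mul hY }

lemma unitRep_ofBisection_of_subset_iso [EtaleGroupoid X] (hY : IsInvariant Y)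
    {U : Set (Arr X)} (hU : IsCompactOpenBisection U) (hiso : U ⊆ iso X) (φ : Y → S) :
    unitRep S hY (ofBisection S hU) φ = (Subtype.val ⁻¹' (src '' U)).indicator φ := by
  have himage : tgt '' U = src '' U := Set.image_congr fun α hα => (hiso hα).symm
  funext ⟨y, hy⟩
  by_cases hyU : y ∈ tgt '' U
  · rw [Set.indicator_of_mem (show (⟨y, hy⟩ : Y) ∈ Subtype.val ⁻¹' (src '' U) from himage ▸ hyU)]
    obtain ⟨α, hα, rfl⟩ := hyU
    exact (unitRepLinear_ofBisection_apply_tgt hY hU φ hα hy).trans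
      (congrArg φ (Subtype.ext (hiso hα)))
  · rw [Set.indicator_of_notMem
      (show (⟨y, hy⟩ : Y) ∉ Subtype.val ⁻¹' (src '' U) from himage ▸ hyU)]
    exact unitRepLinear_ofBisection_apply_of_notMem hY hU φ hyU

end UnitRepresentation

section Simplicity

variable {S : Type*} {X : Type u} [CommSemiring S] [Nontrivial S] [Groupoid.{v} X]
  [TopologicalSpace X] [TopologicalSpace (Arr X)] [AmpleGroupoid X]

theorem IsCongruenceSimple.unitRep_injective
    (hsimple : IsCongruenceSimple (steinbergAlgebra S X)) {Y : Set X} (hY : IsInvariant Y)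
    (hne : Y.Nonempty) : Function.Injective (unitRep S hY) := by
  refine (hsimple.injective_or_eq_zero _).resolve_right fun hzero => ?_
  obtain ⟨y, hy⟩ := hne
  obtain ⟨K, hK, hKo, hyK, -⟩ := exists_isCompact_isOpen_subset isOpen_univ (Set.mem_univ y)
  have hone := unitRep_ofBisection_of_subset_iso hY (.image_unit hK hKo)
    (image_unit_subset_iso K) (1 : Y → S)
  rw [hzero, image_src_image_unit] at hone
  have hval := congrFun hone ⟨y, hy⟩
  rw [Set.indicator_of_mem (show (⟨y, hy⟩ : Y) ∈ Subtype.val ⁻¹' K from hyK)] at hval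
  exact zero_ne_one hval

theorem IsCongruenceSimple.eq_of_inter_image_src_eq
    (hsimple : IsCongruenceSimple (steinbergAlgebra S X)) {Y : Set X} (hY : IsInvariant Y)
    (hne : Y.Nonempty) {U V : Set (Arr X)} (hU : IsCompactOpenBisection U)
    (hV : IsCompactOpenBisection V) (hUiso : U ⊆ iso X) (hViso : V ⊆ iso X)
    (h : Y ∩ src '' U = Y ∩ src '' V) : U = V := by
  refine eq_of_ofBisection_eq (S := S) (hU := hU) (hV := hV)
    (hsimple.unitRep_injective hY hne (LinearMap.ext fun φ => ?_))
  rw [unitRep_ofBisection_of_subset_iso hY hU hUiso, unitRep_ofBisection_of_subset_iso hY hV hViso,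
    (Subtype.preimage_val_eq_preimage_val_iff Y _ _).2 h]

theorem IsCongruenceSimple.isMinimalGroupoid
    (hsimple : IsCongruenceSimple (steinbergAlgebra S X)) : IsMinimalGroupoid X := by
  intro D hDo hD
  by_contra! ⟨⟨x, hx⟩, huniv⟩
  obtain ⟨K, hK, hKo, hxK, hKD⟩ := exists_isCompact_isOpen_subset hDo hx
  have hK_eq : unit '' K = unit '' (∅ : Set X) :=
    hsimple.eq_of_inter_image_src_eq hD.compl (Set.nonempty_compl.2 huniv) (.image_unit hK hKo)
      (.image_unit isCompact_empty isOpen_empty) (image_unit_subset_iso K)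
      (image_unit_subset_iso ∅) <| by
        rw [image_src_image_unit, image_src_image_unit, Set.inter_empty,
          (disjoint_compl_left.mono_right hKD).inter_eq]
  exact (hK_eq ▸ Set.mem_image_of_mem unit hxK : unit x ∈ unit '' (∅ : Set X)).elim
    fun _ h => h.1

theorem IsCongruenceSimple.isEffectiveGroupoid
    (hsimple : IsCongruenceSimple (steinbergAlgebra S X)) : IsEffectiveGroupoid X := by
  refine Set.Subset.antisymm (fun γ hγ => ?_) <| interior_maximal
    (Set.image_univ ▸ image_unit_subset_iso Set.univ) isOpenMap_unit.isOpen_range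
  obtain ⟨U, hU, hγU, hUW⟩ := exists_isCompactOpenBisection_subset isOpen_interior hγ
  have hU_eq : U = unit '' (src '' U) :=
    hsimple.eq_of_inter_image_src_eq (fun _ _ => Set.mem_univ _) ⟨γ.src, Set.mem_univ _⟩ hU
      hU.image_unit_image_src (hUW.trans interior_subset) (image_unit_subset_iso _)
      (by rw [image_src_image_unit])
  exact Set.image_subset_range unit _ (hU_eq ▸ hγU)

end Simplicity

end Steinberg

/-- `IsField` does not provide additive inverses in a semiring, hence the clause `IsAddUnit 1`. -/
theorem proposition3p2_general {S : Type*} [CommSemiring S] [Nontrivial S] {X : Type*}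
    [CategoryTheory.Groupoid X] [TopologicalSpace X] [TopologicalSpace (Steinberg.Arr X)]
    [Steinberg.AmpleGroupoid X] [Nonempty X]
    (hsimple : Steinberg.IsCongruenceSimple (Steinberg.steinbergAlgebra S X)) :
    ((IsField S ∧ IsAddUnit (1 : S)) ∨ Nonempty (S ≃+* Steinberg.BooleanSemifield)) ∧
      Steinberg.IsMinimalGroupoid X ∧ Steinberg.IsEffectiveGroupoid X :=
  ⟨hsimple.of_steinbergAlgebra.isField_or_nonempty_ringEquiv, hsimple.isMinimalGroupoid,
    hsimple.isEffectiveGroupoid⟩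

theorem proposition3p2 {S : Type*} [Semifield S] {X : Type*} [CategoryTheory.Groupoid X]
    [TopologicalSpace X] [TopologicalSpace (Steinberg.Arr X)] [Steinberg.AmpleGroupoid X]
    [Nonempty X]
    (hsimple : Steinberg.IsCongruenceSimple (Steinberg.steinbergAlgebra S X)) :
    ((∃ F : Field S, F.toSemifield = ‹Semifield S›) ∨
        Nonempty (S ≃+* Steinberg.BooleanSemifield)) ∧
      Steinberg.IsMinimalGroupoid X ∧ Steinberg.IsEffectiveGroupoid X :=
  (proposition3p2_general hsimple).imp_left
    (Or.imp_left fun hfield => Steinberg.exists_field_toSemifield_eq hfield.2)
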